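/- All graphs are finite and simple. Let $G$ be a connected chordal graph, i.e. every cycle of $G$ with at least four vertices has a chord. The reduced clique graph $C_R(G)$ has the maximal cliques of $G$ as its vertices; two distinct maximal cliques $C, C'$ are adjacent in $C_R(G)$ if and only if $C\cap C'\neq\emptyset$ and there is no path of $G$ from a vertex of $C\setminus C'$ to a vertex of $C'\setminus C$ with no internal vertex in $C\cap C'$. A clique tree of $G$ is a tree $T$ whose vertices are the maximal cliques of $G$ such that, for every $v\in V(G)$, the maximal cliques containing $v$ induce a subtree of $T$. A legitimate weighting of $G$ is a function $\sigma$ from $\{\emptyset\}\cup\{C\cap C' : C, C' \text{ distinct maximal cliques of } G\}$ to the non-negative integers such that $\sigma(\emptyset)=0$ and $\sigma(X)<\sigma(X')$ whenever $X\subsetneq X'$ are in the domain of $\sigma$. The $\sigma$-weight of a spanning tree of $C_R(G)$ is the sum of $\sigma(C\cap C')$ over its edges $CC'$. Then: 1. Every clique tree of $G$ is a spanning tree of $C_R(G)$. 2. Every edge of $C_R(G)$ is contained in a clique tree of $G$. 3. For every legitimate weighting $\sigma$ of $G$, a spanning tree of $C_R(G)$ is a clique tree if and only if it has maximum $\sigma$-weight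 amongst all spanning trees of $C_R(G)$. 4. In particular, $X\mapsto |X|$ is a legitimate weighting of $G$, and hence a spanning tree $T$ of $C_R(G)$ is a clique tree if and only if it has maximum weight amongst all spanning trees of $C_R(G)$, where the edge joining $C$ and $C'$ is weighted with $|C\cap C'|$. -/

import Mathlib

namespace SimpleGraph

variable {V : Type*}

/-- A graph is chordal if every cycle with at least four vertices has a chord: an edge of the graph
that joins two vertices of the cycle and is not an edge of the cycle. -/
def IsChordal (G : SimpleGraph V) : Prop :=
  ∀ ⦃u : V⦄ (c : G.Walk u u), c.IsCycle → 4 ≤ c.length →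
    ∃ a ∈ c.support, ∃ b ∈ c.support, G.Adj a b ∧ s(a, b) ∉ c.edges

/-- The type of (inclusion-wise) maximal cliques of a graph. -/
abbrev MaxClique (G : SimpleGraph V) : Type _ :=
  {C : Finset V // Maximal (fun s : Finset V => G.IsClique (s : Set V)) C}

/-- A path from `a` to `b` avoids `S` if none of its internal vertices is in `S`. -/
def Walk.Avoids {G : SimpleGraph V} {a b : V} (p : G.Walk a b) (S : Finset V) : Prop :=
  ∀ x ∈ p.support, x ≠ a → x ≠ b → x ∉ S

/-- `C` and `D` form a separating pair: no `(C ∩ D)`-avoiding path runs from a vertex of `C \ D`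
to a vertex of `D \ C`. -/
def IsSeparatingPair [DecidableEq V] (G : SimpleGraph V) (C D : Finset V) : Prop :=
  ¬ ∃ a ∈ C \ D, ∃ b ∈ D \ C, ∃ p : G.Walk a b, p.IsPath ∧ p.Avoids (C ∩ D)

/-- Reversing an avoiding path shows that being a separating pair is symmetric. -/
theorem IsSeparatingPair.symm [DecidableEq V] {G : SimpleGraph V} {C D : Finset V}
    (h : G.IsSeparatingPair C D) : G.IsSeparatingPair D C := by
  rintro ⟨a, ha, b, hb, p, hp, hav⟩
  refine h ⟨b, hb, a, ha, p.reverse, hp.reverse, ?_⟩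
  intro x hx hxb hxa
  rw [Finset.inter_comm]
  exact hav x (by simpa using hx) hxa hxb

/-- The reduced clique graph: its vertices are the maximal cliques, and two distinct maximal
cliques are adjacent if they intersect and form a separating pair. -/
def reducedCliqueGraph [DecidableEq V] (G : SimpleGraph V) : SimpleGraph G.MaxClique where
  Adj C D := C ≠ D ∧ (C.1 ∩ D.1).Nonempty ∧ G.IsSeparatingPair C.1 D.1
  symm := ⟨fun _ _ h => ⟨h.1.symm, by rw [Finset.inter_comm]; exact h.2.1, h.2.2.symm⟩⟩
  loopless := ⟨fun _ h => h.1 rfl⟩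

/-- A clique tree: a tree on the maximal cliques in which, for every vertex `v`, the maximal cliques
containing `v` induce a subtree. -/
def IsCliqueTree (G : SimpleGraph V) (T : SimpleGraph G.MaxClique) : Prop :=
  T.IsTree ∧ ∀ v : V, (T.induce {C : G.MaxClique | v ∈ C.1}).IsTree

/-- `T` is a spanning tree of `H`. -/
def IsSpanningTreeOf {W : Type*} (T H : SimpleGraph W) : Prop :=
  T ≤ H ∧ T.IsTree

/-- The sets on which a weighting has to be specified: the empty set and all intersections of two
distinct maximal cliques. -/
def weightDomain [DecidableEq V] (G : SimpleGraph V) : Set (Finset V) :=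
  {∅} ∪ {X | ∃ C D : G.MaxClique, C ≠ D ∧ X = C.1 ∩ D.1}

/-- A legitimate weighting; values of `σ` outside `G.weightDomain` are irrelevant. -/
def IsLegitimateWeighting [DecidableEq V] (G : SimpleGraph V) (σ : Finset V → ℕ) : Prop :=
  σ ∅ = 0 ∧ ∀ X ∈ G.weightDomain, ∀ Y ∈ G.weightDomain, X ⊂ Y → σ X < σ Y

/-- The weight `σ (C ∩ D)` of the edge joining `C` and `D`. -/
def edgeWeight [DecidableEq V] (G : SimpleGraph V) (σ : Finset V → ℕ) : Sym2 G.MaxClique → ℕ :=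
  Sym2.lift ⟨fun C D => σ (C.1 ∩ D.1), fun C D => congrArg σ (Finset.inter_comm C.1 D.1)⟩

open Classical in
/-- The total `σ`-weight of the edges of a graph on the maximal cliques. -/
noncomputable def totalWeight [Fintype V] [DecidableEq V] (G : SimpleGraph V) (σ : Finset V → ℕ)
    (T : SimpleGraph G.MaxClique) : ℕ :=
  ∑ e ∈ T.edgeFinset, G.edgeWeight σ e

/-- `T` is a spanning tree of the reduced clique graph whose `σ`-weight is maximum amongst all
spanning trees of the reduced clique graph. -/
def IsMaxWeightSpanningTree [Fintype V] [DecidableEq V] (G : SimpleGraph V) (σ : Finset V → ℕ)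
    (T : SimpleGraph G.MaxClique) : Prop :=
  T.IsSpanningTreeOf G.reducedCliqueGraph ∧
    ∀ T' : SimpleGraph G.MaxClique, T'.IsSpanningTreeOf G.reducedCliqueGraph →
      G.totalWeight σ T' ≤ G.totalWeight σ T

end SimpleGraph

/-! Everything is an exchange along tree paths. In a clique tree `T`, each edge `PQ` on the path
from `C` to `D` satisfies `C ∩ D ⊆ P ∩ Q`; if equality holds, replacing `PQ` by `CD` gives a clique
tree again. By symmetric exchange, any tree `T'` can be moved to `T` without losing weight, so
clique trees have maximum weight. If `T'` is itself a maximum, strict monotonicity of the weighting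
forces equality in each exchange, and `T` can instead be moved to `T'` through clique trees.

Deleting an edge `CD` of a clique tree separates the two sides of `G` outside `C ∩ D`; so clique
trees lie in the reduced clique graph. Conversely, if `C ∩ D` separates, some edge `PQ` on the path
from `C` to `D` has `P ∩ Q ⊆ C ∩ D` and can be swapped for `CD`.

Chordality serves only to provide one clique tree: a tree on the maximal cliques with maximum total
intersection size (`IsChordal.isCliqueTree_of_forall_totalWeight_le`). -/

namespace SimpleGraph

/-! ### Reachability within a vertex set, and shortest paths -/

section General

variable {W : Type*} {G H : SimpleGraph W}

/-- The spanning subgraph of `G` whose edges are those with both ends in `U`. -/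
def restrictTo (G : SimpleGraph W) (U : Set W) : SimpleGraph W where
  Adj x y := G.Adj x y ∧ x ∈ U ∧ y ∈ U
  symm := ⟨fun _ _ h => ⟨h.1.symm, h.2.2, h.2.1⟩⟩
  loopless := ⟨fun _ h => h.1.ne rfl⟩

theorem restrictTo_le (G : SimpleGraph W) (U : Set W) : G.restrictTo U ≤ G := fun _ _ h => h.1

theorem restrictTo_anti {U U' : Set W} (h : U ⊆ U') : G.restrictTo U ≤ G.restrictTo U' :=
  fun _ _ hxy => ⟨hxy.1, h hxy.2.1, h hxy.2.2⟩

theorem Walk.support_subset_of_restrictTo {U : Set W} {x y : W} (p : (G.restrictTo U).Walk x y)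
    (hx : x ∈ U) : ∀ z ∈ p.support, z ∈ U := by
  induction p with
  | nil => simpa using hx
  | cons h p ih =>
    intro z hz
    rw [Walk.support_cons, List.mem_cons] at hz
    rcases hz with rfl | hz
    · exact hx
    · exact ih h.2.2 z hz

theorem Walk.reachable_restrictTo {U : Set W} {x y : W} (p : G.Walk x y)
    (hp : ∀ z ∈ p.support, z ∈ U) : (G.restrictTo U).Reachable x y := by
  induction p with
  | nil => exact Reachable.refl _
  | cons h p ih =>
    have hadj : (G.restrictTo U).Adj _ _ := ⟨h, hp _ (by simp), hp _ (by simp)⟩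
    exact hadj.reachable.trans (ih fun z hz => hp z (by simp [hz]))

theorem reachable_induce_iff {U : Set W} (x y : U) :
    (G.induce U).Reachable x y ↔ (G.restrictTo U).Reachable x y := by
  constructor
  · rintro ⟨p⟩
    let f : G.induce U →g G.restrictTo U := ⟨Subtype.val, fun {a b} h => ⟨h, a.2, b.2⟩⟩
    exact ⟨p.map f⟩
  · rintro ⟨p⟩
    refine ⟨(p.mapLe (G.restrictTo_le U)).induce U fun z hz => ?_⟩
    exact p.support_subset_of_restrictTo x.2 z (by simpa using hz)

theorem Walk.reachable_of_forall_mem_edges {x y : W} (p : G.Walk x y)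
    (h : ∀ a b, s(a, b) ∈ p.edges → H.Reachable a b) : H.Reachable x y := by
  induction p with
  | nil => exact Reachable.refl _
  | cons hadj p ih =>
    exact (h _ _ (by simp)).trans (ih fun a b hab => h a b (by simp [hab]))

theorem Reachable.of_forall_adj (h : ∀ x y, G.Adj x y → H.Reachable x y) {x y : W}
    (hxy : G.Reachable x y) : H.Reachable x y := by
  obtain ⟨p⟩ := hxy
  exact p.reachable_of_forall_mem_edges fun a b hab => h a b (p.adj_of_mem_edges hab)

/-- If a graph joins the ends of a trail and the ends of all edges of the trail but one, then it
joins the ends of the remaining edge, too. -/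
theorem Walk.IsTrail.reachable_of_mem_edges {u v x y : W} {p : G.Walk u v} (hp : p.IsTrail)
    (he : s(x, y) ∈ p.edges)
    (h : ∀ a b, s(a, b) ∈ p.edges → s(a, b) ≠ s(x, y) → H.Reachable a b)
    (huv : H.Reachable u v) : H.Reachable x y := by
  induction p with
  | nil => simp at he
  | @cons a b c hab p ih =>
    rw [Walk.isTrail_cons] at hp
    by_cases hxy : s(a, b) = s(x, y)
    · have hbc : H.Reachable b c := by
        refine p.reachable_of_forall_mem_edges fun a' b' hab' => h a' b' (by simp [hab']) ?_
        rintro h'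
        exact hp.2 (hxy.trans h'.symm ▸ hab')
      have hab' := huv.trans hbc.symm
      rcases Sym2.eq_iff.1 hxy with ⟨rfl, rfl⟩ | ⟨rfl, rfl⟩
      · exact hab'
      · exact hab'.symm
    · refine ih hp.1 ?_ (fun a' b' hab' => h a' b' (by simp [hab']))
        ((h a b (by simp) hxy).symm.trans huv)
      rw [Walk.edges_cons, List.mem_cons] at he
      exact he.resolve_left fun h' => hxy h'.symm

theorem Walk.exists_mem_edges_not_reachable {u v : W} (p : G.Walk u v) (h : ¬ H.Reachable u v) :
    ∃ x y, s(x, y) ∈ p.edges ∧ ¬ H.Reachable x y := by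
  by_contra! hcon
  exact h (p.reachable_of_forall_mem_edges hcon)

/-- A shortest path in `G.restrictTo U` is a chordless path of `G`. -/
theorem exists_isChordless_of_reachable_restrictTo {U : Set W} {a b : W} (ha : a ∈ U)
    (h : (G.restrictTo U).Reachable a b) :
    ∃ p : G.Walk a b, p.IsPath ∧ p.IsChordless ∧ ∀ x ∈ p.support, x ∈ U := by
  classical
  obtain ⟨p, hp, hlen⟩ := h.exists_path_of_dist
  have hU := p.support_subset_of_restrictTo ha
  refine ⟨p.mapLe (G.restrictTo_le U), (Walk.isPath_mapLe _).2 hp, ?_, by simpa using hU⟩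
  rw [Walk.isChordless_iff_forall_mem_edges]
  simp only [Walk.support_mapLe_eq_support, Walk.edges_mapLe_eq_edges]
  -- Subwalks of a shortest path are shortest, so one with adjacent ends is a single edge.
  have key : ∀ {x y} (q : (G.restrictTo U).Walk x y), q.IsSubwalk p → G.Adj x y →
      s(x, y) ∈ p.edges := by
    intro x y q hq hxy
    have hadj : (G.restrictTo U).Adj x y :=
      ⟨hxy, hU x (hq.support_subset q.start_mem_support),
        hU y (hq.support_subset q.end_mem_support)⟩
    have hd := length_eq_dist_of_subwalk hlen hq
    rw [dist_eq_one_iff_adj.2 hadj] at hd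
    refine hq.edges_subset ?_
    match q, hd with
    | .cons _ .nil, _ => simp
  intro x y hx hy hxy
  rw [← p.take_spec hx, Walk.mem_support_append_iff] at hy
  rcases hy with hy' | hy'
  · rw [Sym2.eq_swap]
    exact key ((p.takeUntil x hx).dropUntil y hy')
      ((Walk.isSubwalk_dropUntil _ hy').trans (p.isSubwalk_takeUntil hx)) hxy.symm
  · exact key ((p.dropUntil x hx).takeUntil y hy')
      ((Walk.isSubwalk_takeUntil _ hy').trans (p.isSubwalk_dropUntil hx)) hxy

end General

/-! ### Edge exchange in trees -/

section Swap

variable {W : Type*} {T T' : SimpleGraph W}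

/-- Delete the edge `e` and add the edge `f`. -/
def swapEdge (T : SimpleGraph W) (e f : Sym2 W) : SimpleGraph W :=
  fromEdgeSet (insert f (T.edgeSet \ {e}))

theorem edgeSet_swapEdge (T : SimpleGraph W) (e : Sym2 W) {f : Sym2 W} (hf : ¬ f.IsDiag) :
    (T.swapEdge e f).edgeSet = insert f (T.edgeSet \ {e}) := by
  rw [swapEdge, edgeSet_fromEdgeSet]
  ext g
  simp only [Set.mem_sdiff, Set.mem_insert_iff, Set.mem_singleton_iff, Sym2.mem_diagSet]
  constructor
  · exact fun h => h.1
  · rintro (rfl | h)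
    · exact ⟨Or.inl rfl, hf⟩
    · exact ⟨Or.inr h, T.not_isDiag_of_mem_edgeSet h.1⟩

theorem IsTree.swapEdge [Finite W] (hT : T.IsTree) {u v : W} (huv : u ≠ v) (hf : ¬ T.Adj u v)
    {p : T.Walk u v} (hp : p.IsTrail) {e : Sym2 W} (he : e ∈ p.edges) :
    (T.swapEdge e s(u, v)).IsTree := by
  have hdiag : ¬ (s(u, v)).IsDiag := huv
  have hE := T.edgeSet_swapEdge e hdiag
  -- The swap preserves the number of edges, so acyclicity follows from connectedness.
  rw [isTree_iff_connected_and_card] at hT ⊢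
  have hstay : ∀ x y, T.Adj x y → s(x, y) ≠ e → (T.swapEdge e s(u, v)).Reachable x y := by
    intro x y hxy hne
    refine Adj.reachable ?_
    rw [← mem_edgeSet, hE]
    exact Or.inr ⟨hxy, hne⟩
  have hnew : (T.swapEdge e s(u, v)).Reachable u v := by
    refine Adj.reachable ?_
    rw [← mem_edgeSet, hE]
    exact Or.inl rfl
  constructor
  · have := hT.1.nonempty
    refine ⟨fun x y => (hT.1.preconnected x y).of_forall_adj fun a b hab => ?_⟩
    by_cases hne : s(a, b) = e
    · subst hne
      exact hp.reachable_of_mem_edges he (fun c d hcd => hstay c d (p.adj_of_mem_edges hcd)) hnew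
    · exact hstay a b hab hne
  · rw [Nat.card_coe_set_eq, hE, Set.ncard_insert_of_notMem (fun h => hf h.1),
      Set.ncard_sdiff_singleton_add_one (p.edges_subset_edgeSet he), ← hT.2, Nat.card_coe_set_eq]

/-- Symmetric exchange of edges between two trees on the same vertices. -/
theorem IsTree.exists_swapEdge [Finite W] (hT : T.IsTree) (hT' : T'.IsTree) {u v : W}
    (h' : T'.Adj u v) (h : ¬ T.Adj u v) {p : T.Walk u v} (hp : p.IsTrail) :
    ∃ e ∈ p.edges, e ∉ T'.edgeSet ∧ (T.swapEdge e s(u, v)).IsTree ∧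
      (T'.swapEdge s(u, v) e).IsTree := by
  -- Deleting `uv` splits `T'`, and `p` must cross this cut; a crossing edge serves both swaps.
  have hbr := isAcyclic_iff_forall_adj_isBridge.1 hT'.isAcyclic h'
  rw [isBridge_iff] at hbr
  obtain ⟨x, y, hxy, hnr⟩ := p.exists_mem_edges_not_reachable hbr
  have hadj : T.Adj x y := p.adj_of_mem_edges hxy
  have hne : s(x, y) ≠ s(u, v) := by
    intro heq
    rw [← mem_edgeSet, ← heq] at h
    exact h hadj
  have hnot : ¬ T'.Adj x y := fun hadj' =>
    hnr (Adj.reachable (by rw [deleteEdges_adj]; exact ⟨hadj', hne⟩))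
  obtain ⟨q, hq, -⟩ := hT'.existsUnique_path x y
  exact ⟨s(x, y), hxy, hnot, hT.swapEdge h'.ne h hp hxy,
    hT'.swapEdge hadj.ne hnot hq.isTrail (q.mem_edges_of_not_reachable_deleteEdges hnr)⟩

theorem IsTree.eq_of_le (hT : T.IsTree) (hT' : T'.IsTree) (h : T' ≤ T) : T' = T :=
  le_antisymm h ((isTree_iff_minimal_connected.1 hT).2 hT'.connected h)

theorem IsTree.exists_adj_of_ne (hT : T.IsTree) (hT' : T'.IsTree) (h : T' ≠ T) :
    ∃ C D, T'.Adj C D ∧ ¬ T.Adj C D := by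
  by_contra! hcon
  exact h (hT.eq_of_le hT' fun C D => hcon C D)

theorem totalWeight_swapEdge {V : Type*} [Fintype V] [DecidableEq V] {G : SimpleGraph V}
    (σ : Finset V → ℕ) {T : SimpleGraph G.MaxClique} {e f : Sym2 G.MaxClique}
    (he : e ∈ T.edgeSet) (hf : f ∉ T.edgeSet) (hdiag : ¬ f.IsDiag) :
    G.totalWeight σ (T.swapEdge e f) + G.edgeWeight σ e =
      G.totalWeight σ T + G.edgeWeight σ f := by
  classical
  have h : (T.swapEdge e f).edgeFinset = insert f (T.edgeFinset.erase e) := by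
    ext g
    rw [mem_edgeFinset, edgeSet_swapEdge _ _ hdiag]
    simp [and_comm]
  have h1 : G.totalWeight σ (T.swapEdge e f) =
      ∑ g ∈ insert f (T.edgeFinset.erase e), G.edgeWeight σ g := by
    rw [← h]
    unfold totalWeight
    congr!
  have h2 : G.totalWeight σ T = ∑ g ∈ T.edgeFinset, G.edgeWeight σ g := by
    unfold totalWeight
    congr!
  rw [h1, h2, Finset.sum_insert (by simp [hf]), ← Finset.sum_erase_add _ _ (mem_edgeFinset.2 he)]
  ring

end Swap

/-! ### Chordless paths in chordal graphs -/

section Chordal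

variable {V : Type*} {G : SimpleGraph V}

theorem Walk.IsChordless.of_append_left {u v w : V} {p : G.Walk u v} {q : G.Walk v w}
    (hpath : (p.append q).IsPath) (h : (p.append q).IsChordless) : p.IsChordless := by
  rw [Walk.isChordless_iff_forall_mem_edges] at h ⊢
  intro x y hx hy hxy
  have hmem := h (Walk.support_subset_support_append_left _ _ hx)
    (Walk.support_subset_support_append_left _ _ hy) hxy
  rw [Walk.edges_append, List.mem_append] at hmem
  refine hmem.resolve_right fun hq => ?_
  have hxq := q.fst_mem_support_of_mem_edges hq
  have hyq := q.snd_mem_support_of_mem_edges hq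
  by_cases hxv : x = v
  · exact hpath.ne_of_mem_support_of_append (hxv ▸ hxy.ne') hy hyq rfl
  · exact hpath.ne_of_mem_support_of_append hxv hx hxq rfl

theorem Walk.IsChordless.reverse {u v : V} {p : G.Walk u v} (h : p.IsChordless) :
    p.reverse.IsChordless := by
  rw [Walk.isChordless_iff_forall_mem_edges] at h ⊢
  simpa using h

theorem Walk.IsChordless.of_append_right {u v w : V} {p : G.Walk u v} {q : G.Walk v w}
    (hpath : (p.append q).IsPath) (h : (p.append q).IsChordless) : q.IsChordless := by
  have h1 := h.reverse
  have h2 := hpath.reverse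
  rw [Walk.reverse_append] at h1 h2
  simpa using (Walk.IsChordless.of_append_left h2 h1).reverse

/-- In a chordal graph, a vertex adjacent to both ends of a chordless path that avoids it is
adjacent to all vertices of the path. -/
theorem IsChordal.adj_of_mem_support (hG : G.IsChordal) {s a b : V} {p : G.Walk a b}
    (hp : p.IsPath) (hc : p.IsChordless) (hs : s ∉ p.support) (ha : G.Adj s a) (hb : G.Adj s b) :
    ∀ x ∈ p.support, G.Adj s x := by
  induction hn : p.length using Nat.strong_induction_on generalizing a b with
  | _ n ih =>
  by_cases hlen : p.length ≤ 1
  · intro x hx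
    match p, hlen with
    | .nil, _ =>
      obtain rfl : x = a := by simpa using hx
      exact ha
    | .cons _ .nil, _ =>
      have : x = a ∨ x = b := by simpa using hx
      rcases this with rfl | rfl
      · exact ha
      · exact hb
  have hsb : s(b, s) ∉ p.edges := fun h => hs (p.snd_mem_support_of_mem_edges h)
  have hab : a ≠ b := by
    rintro rfl
    rw [(Walk.isPath_iff_nil.1 hp).length_eq_zero] at hlen
    simp at hlen
  have hcyc : (Walk.cons ha (p.concat hb.symm)).IsCycle := by
    rw [Walk.cons_isCycle_iff]
    refine ⟨hp.concat hs _, ?_⟩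
    rw [Walk.edges_concat, List.concat_eq_append, List.mem_append, List.mem_singleton]
    rintro (h | h)
    · exact hs (p.fst_mem_support_of_mem_edges h)
    · rw [Sym2.eq_swap, Sym2.eq_iff] at h
      rcases h with h | h
      · exact hab h.1
      · exact hb.ne h.2
  obtain ⟨x, hx, y, hy, hxy, hne⟩ := hG _ hcyc (by
    rw [Walk.length_cons, Walk.length_concat]; omega)
  have hsup : ∀ z, z ∈ (Walk.cons ha (p.concat hb.symm)).support ↔ z = s ∨ z ∈ p.support := by
    intro z
    simp [Walk.support_concat]
    tauto
  have hedge : ∀ g, g ∈ (Walk.cons ha (p.concat hb.symm)).edges ↔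
      g = s(s, a) ∨ g ∈ p.edges ∨ g = s(b, s) := by
    intro g
    simp [Walk.edges_concat]
  rw [hsup] at hx hy
  rw [hedge] at hne
  push Not at hne
  -- As `p` is chordless, the chord of the cycle ends in `s`. Its other end splits `p` into two
  -- shorter paths.
  obtain ⟨x, hx, hsx, hxa, hxb⟩ : ∃ x ∈ p.support, G.Adj s x ∧ x ≠ a ∧ x ≠ b := by
    rcases hx with rfl | hx
    · rcases hy with rfl | hy
      · exact absurd hxy G.irrefl
      · refine ⟨y, hy, hxy, ?_, ?_⟩
        · rintro rfl
          exact hne.1 rfl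
        · rintro rfl
          exact hne.2.2 Sym2.eq_swap
    · rcases hy with rfl | hy
      · refine ⟨x, hx, hxy.symm, ?_, ?_⟩
        · rintro rfl
          exact hne.1 Sym2.eq_swap
        · rintro rfl
          exact hne.2.2 rfl
      · exact absurd (hc.mem_edges hx hy hxy) hne.2.1
  obtain ⟨q, r, hq, hr, rfl⟩ := hp.mem_support_iff_exists_append.1 hx
  rw [Walk.mem_support_append_iff] at hs
  push Not at hs
  have hq0 : q.length ≠ 0 := fun h => hxa (Walk.eq_of_length_eq_zero h).symm
  have hr0 : r.length ≠ 0 := fun h => hxb (Walk.eq_of_length_eq_zero h)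
  rw [Walk.length_append] at hn
  intro z hz
  rw [Walk.mem_support_append_iff] at hz
  rcases hz with hz | hz
  · exact ih q.length (by omega) hq (hc.of_append_left hp) hs.1 ha hsx rfl z hz
  · exact ih r.length (by omega) hr (hc.of_append_right hp) hs.2 hsx hb rfl z hz

end Chordal

/-! ### Clique trees and separation -/

section CliqueTree

variable {V : Type*} {G : SimpleGraph V} {T : SimpleGraph G.MaxClique}

theorem MaxClique.eq_of_subset {C D : G.MaxClique} (h : C.1 ⊆ D.1) : C = D :=
  Subtype.ext (C.2.eq_of_le D.2.prop h)

theorem MaxClique.exists_mem_notMem {C D : G.MaxClique} (h : C ≠ D) : ∃ a ∈ C.1, a ∉ D.1 :=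
  Finset.not_subset.1 fun hsub => h (MaxClique.eq_of_subset hsub)

theorem MaxClique.reachable_restrictTo {C : G.MaxClique} {U : Set V} {x y : V} (hx : x ∈ C.1)
    (hy : y ∈ C.1) (hxU : x ∈ U) (hyU : y ∈ U) : (G.restrictTo U).Reachable x y := by
  by_cases h : x = y
  · rw [h]
  · exact Adj.reachable ⟨C.2.prop hx hy h, hxU, hyU⟩

/-- The ends lie outside `C ∩ D` anyway, so avoiding it internally means avoiding it altogether. -/
theorem isSeparatingPair_iff [DecidableEq V] {C D : Finset V} : G.IsSeparatingPair C D ↔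
    ∀ a ∈ C \ D, ∀ b ∈ D \ C, ¬ (G.restrictTo {x | x ∉ C ∩ D}).Reachable a b := by
  rw [IsSeparatingPair]
  push Not
  refine forall₄_congr fun a ha b hb => ?_
  rw [Finset.mem_sdiff] at ha hb
  have haS : a ∈ {x | x ∉ C ∩ D} := fun h => ha.2 (Finset.mem_inter.1 h).2
  have hbS : b ∈ {x | x ∉ C ∩ D} := fun h => hb.2 (Finset.mem_inter.1 h).1
  constructor
  · intro h hr
    obtain ⟨p, hp⟩ := hr.exists_isPath
    refine h (p.mapLe (G.restrictTo_le _)) ((Walk.isPath_mapLe _).2 hp) fun x hx _ _ => ?_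
    rw [Walk.support_mapLe_eq_support] at hx
    exact p.support_subset_of_restrictTo haS x hx
  · intro h p _ hav
    refine h (p.reachable_restrictTo fun z hz => ?_)
    by_cases hza : z = a
    · rwa [hza]
    by_cases hzb : z = b
    · rwa [hzb]
    exact hav z hz hza hzb

/-- If all consecutive intersections along a walk of maximal cliques leave `S`, then the walk links
its end cliques outside `S`. -/
theorem reachable_of_forall_not_inter_subset [DecidableEq V] {S : Finset V} {C D : G.MaxClique}
    (p : T.Walk C D) (hp : ∀ P Q : G.MaxClique, s(P, Q) ∈ p.edges → ¬ P.1 ∩ Q.1 ⊆ S) {a b : V}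
    (ha : a ∈ C.1) (haS : a ∉ S) (hb : b ∈ D.1) (hbS : b ∉ S) :
    (G.restrictTo {x | x ∉ S}).Reachable a b := by
  induction p generalizing a with
  | nil => exact MaxClique.reachable_restrictTo ha hb haS hbS
  | @cons C E D hadj p ih =>
    obtain ⟨x, hx, hxS⟩ := Finset.not_subset.1 (hp C E (by simp))
    rw [Finset.mem_inter] at hx
    exact (MaxClique.reachable_restrictTo ha hx.1 haS hxS).trans
      (ih (fun P Q hPQ => hp P Q (by simp [hPQ])) hx.2 hxS hb)

variable [Fintype V]

theorem IsClique.exists_maxClique {s : Finset V} (hs : G.IsClique (s : Set V)) :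
    ∃ C : G.MaxClique, s ⊆ C.1 := by
  obtain ⟨C, hsC, hC⟩ := Finite.exists_le_maximal (p := fun s : Finset V => G.IsClique (s : Set V)) hs
  exact ⟨⟨C, hC⟩, hsC⟩

theorem exists_maxClique_mem (G : SimpleGraph V) (v : V) : ∃ C : G.MaxClique, v ∈ C.1 := by
  obtain ⟨C, hC⟩ := IsClique.exists_maxClique (G := G) (s := {v}) (by simp)
  exact ⟨C, hC (by simp)⟩

theorem isCliqueTree_iff : G.IsCliqueTree T ↔ T.IsTree ∧ ∀ (v : V) (C D : G.MaxClique),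
    v ∈ C.1 → v ∈ D.1 → (T.restrictTo {E | v ∈ E.1}).Reachable C D := by
  refine and_congr_right fun hT => forall_congr' fun v => ⟨fun h C D hC hD => ?_, fun h => ?_⟩
  · exact (reachable_induce_iff (⟨C, hC⟩ : {E : G.MaxClique | v ∈ E.1}) ⟨D, hD⟩).1
      (h.connected.preconnected _ _)
  · obtain ⟨C, hC⟩ := G.exists_maxClique_mem v
    exact ⟨(connected_iff _).2 ⟨fun A B => (reachable_induce_iff A B).2 (h _ _ A.2 B.2),
      ⟨⟨C, hC⟩⟩⟩, hT.isAcyclic.induce _⟩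

/-- The subtree of `v` contains a path from `C` to `D`, which is the only one in `T`. -/
theorem IsCliqueTree.mem_of_mem_support (hT : G.IsCliqueTree T) {C D E : G.MaxClique}
    {p : T.Walk C D} (hp : p.IsPath) (hE : E ∈ p.support) {v : V} (hC : v ∈ C.1) (hD : v ∈ D.1) :
    v ∈ E.1 := by
  classical
  obtain ⟨hT, h⟩ := isCliqueTree_iff.1 hT
  obtain ⟨q, hq⟩ := (h v C D hC hD).exists_isPath
  have heq := (hT.isAcyclic.subsingleton_path _ _).elim ⟨p, hp⟩
    ⟨q.mapLe (T.restrictTo_le _), (Walk.isPath_mapLe _).2 hq⟩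
  rw [Subtype.mk.injEq] at heq
  rw [heq, Walk.support_mapLe_eq_support] at hE
  exact q.support_subset_of_restrictTo (U := {E | v ∈ E.1}) hC E hE

/-- Only subtrees of vertices `v ∈ P ∩ Q` lose an edge. Such a `v` lies in `C ∩ D`, hence in all
cliques on `p`, so the rest of `p` with `CD` is a detour inside its new subtree. -/
theorem IsCliqueTree.swapEdge [DecidableEq V] (hT : G.IsCliqueTree T) {C D P Q : G.MaxClique}
    (hCD : C ≠ D) (hadj : ¬ T.Adj C D) {p : T.Walk C D} (hp : p.IsPath) (he : s(P, Q) ∈ p.edges)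
    (hsub : P.1 ∩ Q.1 ⊆ C.1 ∩ D.1) : G.IsCliqueTree (T.swapEdge s(P, Q) s(C, D)) := by
  have htree := hT.1.swapEdge hCD hadj hp.isTrail he
  have hE := T.edgeSet_swapEdge s(P, Q) (f := s(C, D)) hCD
  refine isCliqueTree_iff.2 ⟨htree, fun v A B hA hB => ?_⟩
  have hstay : ∀ X Y : G.MaxClique, T.Adj X Y → s(X, Y) ≠ s(P, Q) → v ∈ X.1 → v ∈ Y.1 →
      ((T.swapEdge s(P, Q) s(C, D)).restrictTo {E | v ∈ E.1}).Reachable X Y := by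
    intro X Y hXY hne hX hY
    refine Adj.reachable ⟨?_, hX, hY⟩
    rw [← mem_edgeSet, hE]
    exact Or.inr ⟨hXY, hne⟩
  refine ((isCliqueTree_iff.1 hT).2 v A B hA hB).of_forall_adj ?_
  rintro X Y ⟨hXY, hX, hY⟩
  by_cases hne : s(X, Y) = s(P, Q)
  · rw [← hne] at he
    have hv : v ∈ C.1 ∩ D.1 := by
      refine hsub ?_
      rcases Sym2.eq_iff.1 hne with ⟨rfl, rfl⟩ | ⟨rfl, rfl⟩
      · exact Finset.mem_inter.2 ⟨hX, hY⟩
      · exact Finset.mem_inter.2 ⟨hY, hX⟩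
    rw [Finset.mem_inter] at hv
    refine hp.isTrail.reachable_of_mem_edges he (fun A B hAB hne' => ?_) ?_
    · exact hstay A B (p.adj_of_mem_edges hAB) (hne ▸ hne')
        (hT.mem_of_mem_support hp (p.fst_mem_support_of_mem_edges hAB) hv.1 hv.2)
        (hT.mem_of_mem_support hp (p.snd_mem_support_of_mem_edges hAB) hv.1 hv.2)
    · refine Adj.reachable ⟨?_, hv⟩
      rw [← mem_edgeSet, hE]
      exact Or.inl rfl
  · exact hstay X Y hXY hne hX hY

/-- Adjacent maximal cliques in a clique tree are separated by their intersection. -/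
theorem IsCliqueTree.isSeparatingPair [DecidableEq V] (hT : G.IsCliqueTree T) {C D : G.MaxClique}
    (hadj : T.Adj C D) : G.IsSeparatingPair C.1 D.1 := by
  rw [isSeparatingPair_iff]
  intro a ha b hb hab
  rw [Finset.mem_sdiff] at ha hb
  have hbr := isAcyclic_iff_forall_adj_isBridge.1 hT.1.isAcyclic hadj
  rw [isBridge_iff] at hbr
  -- The subtree of a vertex outside `C ∩ D` does not use `CD`, so it stays on one side.
  have hside : ∀ x ∉ C.1 ∩ D.1, ∀ E F : G.MaxClique, x ∈ E.1 → x ∈ F.1 →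
      (T.deleteEdges {s(C, D)}).Reachable E F := by
    intro x hx E F hE hF
    refine ((isCliqueTree_iff.1 hT).2 x E F hE hF).mono ?_
    rintro X Y ⟨hXY, hX, hY⟩
    rw [deleteEdges_adj]
    refine ⟨hXY, fun h => hx ?_⟩
    rcases Sym2.eq_iff.1 h with ⟨rfl, rfl⟩ | ⟨rfl, rfl⟩
    · exact Finset.mem_inter.2 ⟨hX, hY⟩
    · exact Finset.mem_inter.2 ⟨hY, hX⟩
  have hbD : b ∉ C.1 ∩ D.1 := fun h => hb.2 (Finset.mem_inter.1 h).1
  obtain ⟨p⟩ := hab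
  -- Adjacent vertices share a maximal clique, so their subtrees lie on the same side.
  have key : ∀ {x y : V} (p : (G.restrictTo {x | x ∉ C.1 ∩ D.1}).Walk x y),
      x ∉ C.1 ∩ D.1 → ∀ E F : G.MaxClique, x ∈ E.1 → y ∈ F.1 →
        (T.deleteEdges {s(C, D)}).Reachable E F := by
    intro x y p
    induction p with
    | nil => exact fun hx E F hE hF => hside _ hx E F hE hF
    | @cons x z y hxz p ih =>
      intro hx E F hE hF
      have hcl : G.IsClique (({x, z} : Finset V) : Set V) := by
        rw [Finset.coe_pair, isClique_pair]
        exact fun _ => hxz.1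
      obtain ⟨K, hK⟩ := hcl.exists_maxClique
      exact (hside x hx E K hE (hK (by simp))).trans (ih hxz.2.2 K F (hK (by simp)) hF)
  exact hbr (key p (fun h => ha.2 (Finset.mem_inter.1 h).2) C D ha.1 hb.1)

/-- Connectedness makes the intersections nonempty: the empty set separates nothing in `G`. -/
theorem IsCliqueTree.le_reducedCliqueGraph [DecidableEq V] (hconn : G.Connected)
    (hT : G.IsCliqueTree T) : T ≤ G.reducedCliqueGraph := by
  intro C D hadj
  have hsep := hT.isSeparatingPair hadj
  refine ⟨hadj.ne, ?_, hsep⟩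
  rw [isSeparatingPair_iff] at hsep
  obtain ⟨a, haC, haD⟩ := MaxClique.exists_mem_notMem hadj.ne
  obtain ⟨b, hbD, hbC⟩ := MaxClique.exists_mem_notMem hadj.ne'
  by_contra hemp
  rw [Finset.not_nonempty_iff_eq_empty] at hemp
  refine hsep a (Finset.mem_sdiff.2 ⟨haC, haD⟩) b (Finset.mem_sdiff.2 ⟨hbD, hbC⟩) ?_
  rw [hemp]
  exact (hconn.preconnected a b).mono fun x y hxy => ⟨hxy, by simp, by simp⟩

theorem exists_isCliqueTree_adj [DecidableEq V] (hT : G.IsCliqueTree T) {C D : G.MaxClique}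
    (hadj : G.reducedCliqueGraph.Adj C D) :
    ∃ T' : SimpleGraph G.MaxClique, G.IsCliqueTree T' ∧ T'.Adj C D := by
  by_cases hTadj : T.Adj C D
  · exact ⟨T, hT, hTadj⟩
  obtain ⟨hne, -, hsep⟩ := hadj
  obtain ⟨p, hp, -⟩ := hT.1.existsUnique_path C D
  rw [isSeparatingPair_iff] at hsep
  obtain ⟨a, haC, haD⟩ := MaxClique.exists_mem_notMem hne
  obtain ⟨b, hbD, hbC⟩ := MaxClique.exists_mem_notMem hne.symm
  have hedge : ∃ P Q : G.MaxClique, s(P, Q) ∈ p.edges ∧ P.1 ∩ Q.1 ⊆ C.1 ∩ D.1 := by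
    by_contra! hcon
    exact hsep a (Finset.mem_sdiff.2 ⟨haC, haD⟩) b (Finset.mem_sdiff.2 ⟨hbD, hbC⟩)
      (reachable_of_forall_not_inter_subset p hcon haC (fun h => haD (Finset.mem_inter.1 h).2)
        hbD (fun h => hbC (Finset.mem_inter.1 h).1))
  obtain ⟨P, Q, hPQ, hsub⟩ := hedge
  refine ⟨_, hT.swapEdge hne hTadj hp hPQ hsub, ?_⟩
  rw [← mem_edgeSet, edgeSet_swapEdge _ _ (by exact hne)]
  exact Or.inl rfl

end CliqueTree

/-! ### Existence of a clique tree -/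

section Existence

variable {V : Type*} [Fintype V] [DecidableEq V] {G : SimpleGraph V} {T : SimpleGraph G.MaxClique}

theorem exists_isTree_forall_totalWeight_le [Nonempty V] (G : SimpleGraph V) (σ : Finset V → ℕ) :
    ∃ T : SimpleGraph G.MaxClique, T.IsTree ∧
      ∀ T' : SimpleGraph G.MaxClique, T'.IsTree → G.totalWeight σ T' ≤ G.totalWeight σ T := by
  obtain ⟨v⟩ := ‹Nonempty V›
  obtain ⟨C, -⟩ := G.exists_maxClique_mem v
  have : Nonempty G.MaxClique := ⟨C⟩
  obtain ⟨T₀, -, hT₀⟩ := (connected_top (V := G.MaxClique)).exists_isTree_le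
  obtain ⟨T, hT, hmax⟩ := (Set.toFinite {T : SimpleGraph G.MaxClique | T.IsTree}).exists_maximalFor
    (G.totalWeight σ) _ ⟨T₀, hT₀⟩
  refine ⟨T, hT, fun T' hT' => ?_⟩
  by_contra! hlt
  exact (hmax hT' hlt.le).not_gt hlt

/-- Otherwise swapping `PQ` for `CD` would increase the weight. -/
theorem card_inter_le_of_mem_edges (hT : T.IsTree)
    (hmax : ∀ T' : SimpleGraph G.MaxClique, T'.IsTree →
      G.totalWeight Finset.card T' ≤ G.totalWeight Finset.card T) {C D P Q : G.MaxClique}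
    {p : T.Walk C D} (hp : p.IsPath) (he : s(P, Q) ∈ p.edges) :
    (C.1 ∩ D.1).card ≤ (P.1 ∩ Q.1).card := by
  by_cases hCD : C = D
  · subst hCD
    rw [Walk.edges_eq_nil.2 (Walk.isPath_iff_nil.1 hp)] at he
    simp at he
  by_cases hadj : T.Adj C D
  · have heq := (hT.isAcyclic.subsingleton_path _ _).elim ⟨p, hp⟩ (Path.singleton hadj)
    have hedge : p.edges = [s(C, D)] := by
      have : p = hadj.toWalk := congrArg Subtype.val heq
      rw [this]
      simp
    rw [hedge, List.mem_singleton, Sym2.eq_iff] at he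
    rcases he with ⟨rfl, rfl⟩ | ⟨rfl, rfl⟩
    · rfl
    · rw [Finset.inter_comm]
  · have h1 := hmax _ (hT.swapEdge hCD hadj hp.isTrail he)
    have h2 := totalWeight_swapEdge Finset.card (p.edges_subset_edgeSet he) hadj
      (show ¬ (s(C, D)).IsDiag from hCD)
    have h3 : G.edgeWeight Finset.card s(C, D) = (C.1 ∩ D.1).card := rfl
    have h4 : G.edgeWeight Finset.card s(P, Q) = (P.1 ∩ Q.1).card := rfl
    omega

/-- If two maximal cliques containing `S` are linked outside `S`, then they are joined by a sequence
of maximal cliques with consecutive intersections strictly larger than `S`. -/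
theorem IsChordal.reachable_of_reachable_restrictTo (hG : G.IsChordal) {S : Finset V}
    {H : SimpleGraph G.MaxClique}
    (hH : ∀ C D : G.MaxClique, S ⊂ C.1 ∩ D.1 → H.Reachable C D) {C D : G.MaxClique}
    (hC : S ⊆ C.1) (hD : S ⊆ D.1) {a b : V} (ha : a ∈ C.1) (haS : a ∉ S) (hb : b ∈ D.1)
    (hbS : b ∉ S) (hab : (G.restrictTo {x | x ∉ S}).Reachable a b) : H.Reachable C D := by
  obtain ⟨p, hp, hpc, hpS⟩ := exists_isChordless_of_reachable_restrictTo haS hab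
  have hadj : ∀ x ∈ p.support, ∀ s ∈ S, G.Adj s x := by
    intro x hx s hs
    refine hG.adj_of_mem_support hp hpc (fun h => hpS s h hs) ?_ ?_ x hx
    · exact C.2.prop (hC hs) ha (by rintro rfl; exact haS hs)
    · exact D.2.prop (hD hs) hb (by rintro rfl; exact hbS hs)
  have hss : ∀ {E F : G.MaxClique} {x : V}, S ⊆ E.1 → S ⊆ F.1 → x ∈ E.1 → x ∈ F.1 → x ∉ S →
      S ⊂ E.1 ∩ F.1 := fun hE hF hxE hxF hxS =>
    Finset.ssubset_iff_subset_ne.2 ⟨Finset.subset_inter hE hF, by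
      rintro heq
      exact hxS (heq ▸ Finset.mem_inter.2 ⟨hxE, hxF⟩)⟩
  have hScl : G.IsClique (S : Set V) := C.2.prop.subset (by exact_mod_cast hC)
  clear hp hpc hab
  induction p generalizing C with
  | nil => exact hH C D (hss hC hD ha hb haS)
  | @cons a c b hac p ih =>
    have hcS : c ∉ S := hpS c (by simp)
    have hcl : G.IsClique ((insert a (insert c S) : Finset V) : Set V) := by
      rw [Finset.coe_insert, Finset.coe_insert, isClique_insert, isClique_insert]
      refine ⟨⟨hScl, fun s hs _ => (hadj c (by simp) s hs).symm⟩, fun s hs hne => ?_⟩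
      rcases hs with rfl | hs
      · exact hac
      · exact (hadj a (by simp) s hs).symm
    -- `C` and `K` share `a` besides `S`, and `K` contains `c`, so `K` replaces `C` for the rest of
    -- the path.
    obtain ⟨K, hK⟩ := hcl.exists_maxClique
    have hSK : S ⊆ K.1 := fun s hs => hK (by simp [hs])
    exact (hH C K (hss hC hSK ha (hK (by simp)) haS)).trans
      (ih hSK (hK (by simp)) hcS hb hbS (fun x hx => hpS x (by simp [hx]))
        (fun x hx => hadj x (by simp [hx])))

/-- A spanning tree that maximizes the total size of the intersections is a clique tree. -/
theorem IsChordal.isCliqueTree_of_forall_totalWeight_le (hG : G.IsChordal) (hT : T.IsTree)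
    (hmax : ∀ T' : SimpleGraph G.MaxClique, T'.IsTree →
      G.totalWeight Finset.card T' ≤ G.totalWeight Finset.card T) : G.IsCliqueTree T := by
  -- Downward induction on the size of `S = C ∩ D`: cliques sharing strictly more than `S` are
  -- already joined within the cliques containing `S`.
  have main : ∀ (n : ℕ) (C D : G.MaxClique), Fintype.card V - (C.1 ∩ D.1).card = n →
      (T.restrictTo {E | C.1 ∩ D.1 ⊆ E.1}).Reachable C D := by
    intro n
    induction n using Nat.strong_induction_on with
    | _ n ih =>
    intro C D hn
    obtain ⟨p, hp, -⟩ := hT.existsUnique_path C D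
    have hcard := fun P Q => card_inter_le_of_mem_edges hT hmax hp (P := P) (Q := Q)
    have hCS : C.1 ∩ D.1 ⊆ C.1 := Finset.inter_subset_left
    have hDS : C.1 ∩ D.1 ⊆ D.1 := Finset.inter_subset_right
    generalize C.1 ∩ D.1 = S at hn hcard hCS hDS ⊢
    have hH : ∀ A B : G.MaxClique, S ⊂ A.1 ∩ B.1 → (T.restrictTo {E | S ⊆ E.1}).Reachable A B := by
      intro A B hAB
      have h1 := Finset.card_lt_card hAB
      have h2 := (A.1 ∩ B.1).card_le_univ
      exact (ih _ (by omega) A B rfl).mono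
        (restrictTo_anti fun E hE => hAB.subset.trans hE)
    clear hp hn ih
    -- The first part bridges stretches of `p` whose cliques do not contain `S`: `A` is the clique
    -- containing `S` at which the stretch was entered, still linked outside `S` to the current
    -- clique `C`.
    have key : (∀ (A : G.MaxClique) (a b : V), S ⊆ A.1 → a ∈ A.1 → a ∉ S → b ∈ C.1 → b ∉ S →
          (G.restrictTo {x | x ∉ S}).Reachable a b →
            (T.restrictTo {E | S ⊆ E.1}).Reachable A D) ∧
        (S ⊆ C.1 → (T.restrictTo {E | S ⊆ E.1}).Reachable C D) := by
      clear hCS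
      induction p with
      | nil =>
        exact ⟨fun A a b hA ha haS hb hbS hab =>
          hG.reachable_of_reachable_restrictTo hH hA hDS ha haS hb hbS hab,
          fun _ => Reachable.refl _⟩
      | @cons C E D hadj p ihp =>
        obtain ⟨ih1, ih2⟩ := ihp (fun P Q hPQ => hcard P Q (by simp [hPQ])) hDS
        have hX := hcard C E (by simp)
        -- Since `|C ∩ E| ≥ |S|`, either `C ∩ E = S` or `C ∩ E` leaves `S`.
        have hout : ¬ (S ⊆ C.1 ∧ S ⊆ E.1) → ∃ x ∈ C.1, x ∈ E.1 ∧ x ∉ S := by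
          intro hnot
          have hns : ¬ C.1 ∩ E.1 ⊆ S := by
            intro hsub
            have heq := Finset.eq_of_subset_of_card_le hsub hX
            exact hnot ⟨heq ▸ Finset.inter_subset_left, heq ▸ Finset.inter_subset_right⟩
          obtain ⟨x, hx, hxS⟩ := Finset.not_subset.1 hns
          rw [Finset.mem_inter] at hx
          exact ⟨x, hx.1, hx.2, hxS⟩
        have h2 : S ⊆ C.1 → (T.restrictTo {E | S ⊆ E.1}).Reachable C D := by
          intro hC
          by_cases hE : S ⊆ E.1
          · have hCE : (T.restrictTo {E | S ⊆ E.1}).Adj C E := ⟨hadj, hC, hE⟩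
            exact hCE.reachable.trans (ih2 hE)
          · obtain ⟨x, hxC, hxE, hxS⟩ := hout fun h => hE h.2
            exact ih1 C x x hC hxC hxS hxE hxS (Reachable.refl _)
        refine ⟨fun A a b hA ha haS hb hbS hab => ?_, h2⟩
        by_cases hC : S ⊆ C.1
        · exact (hG.reachable_of_reachable_restrictTo hH hA hC ha haS hb hbS hab).trans (h2 hC)
        · obtain ⟨x, hxC, hxE, hxS⟩ := hout fun h => hC h.1
          exact ih1 A a x hA ha haS hxE hxS
            (hab.trans (MaxClique.reachable_restrictTo hb hxC hbS hxS))
    exact key.2 hCS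
  refine isCliqueTree_iff.2 ⟨hT, fun v C D hC hD => ?_⟩
  exact (main _ C D rfl).mono (restrictTo_anti fun E (hE : C.1 ∩ D.1 ⊆ E.1) =>
    hE (Finset.mem_inter.2 ⟨hC, hD⟩))

theorem IsChordal.exists_isCliqueTree [Nonempty V] (hG : G.IsChordal) :
    ∃ T : SimpleGraph G.MaxClique, G.IsCliqueTree T := by
  obtain ⟨T, hT, hmax⟩ := G.exists_isTree_forall_totalWeight_le Finset.card
  exact ⟨T, hG.isCliqueTree_of_forall_totalWeight_le hT hmax⟩

end Existence

/-! ### Clique trees and maximum weight -/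

section MaxWeight

variable {V : Type*} [DecidableEq V] {G : SimpleGraph V} {T T' : SimpleGraph G.MaxClique}

theorem IsLegitimateWeighting.le_of_subset {σ : Finset V → ℕ} (hσ : G.IsLegitimateWeighting σ)
    {C D P Q : G.MaxClique} (hCD : C ≠ D) (hPQ : P ≠ Q) (h : C.1 ∩ D.1 ⊆ P.1 ∩ Q.1) :
    σ (C.1 ∩ D.1) ≤ σ (P.1 ∩ Q.1) := by
  rcases h.eq_or_ssubset with h | h
  · rw [h]
  · exact (hσ.2 _ (Or.inr ⟨C, D, hCD, rfl⟩) _ (Or.inr ⟨P, Q, hPQ, rfl⟩) h).le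

theorem isLegitimateWeighting_card (G : SimpleGraph V) : G.IsLegitimateWeighting Finset.card :=
  ⟨Finset.card_empty, fun _ _ _ _ h => Finset.card_lt_card h⟩

variable [Fintype V]

/-- An edge of a tree `T'` that is missing in a clique tree `T` can be exchanged for an edge of `T`
that is missing in `T'` and has at least the same intersection. -/
theorem IsCliqueTree.exists_swapEdge (hT : G.IsCliqueTree T) (hT' : T'.IsTree)
    {C D : G.MaxClique} (h' : T'.Adj C D) (h : ¬ T.Adj C D) :
    ∃ P Q : G.MaxClique, T.Adj P Q ∧ ¬ T'.Adj P Q ∧ C.1 ∩ D.1 ⊆ P.1 ∩ Q.1 ∧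
      (T'.swapEdge s(C, D) s(P, Q)).IsTree ∧
      (P.1 ∩ Q.1 ⊆ C.1 ∩ D.1 → G.IsCliqueTree (T.swapEdge s(P, Q) s(C, D))) := by
  obtain ⟨p, hp, -⟩ := hT.1.existsUnique_path C D
  obtain ⟨e, he, heT', -, htree⟩ := hT.1.exists_swapEdge hT' h' h hp.isTrail
  induction e with
  | _ P Q =>
  refine ⟨P, Q, p.adj_of_mem_edges he, heT', fun v hv => ?_, htree,
    hT.swapEdge h'.ne h hp he⟩
  rw [Finset.mem_inter] at hv ⊢
  exact ⟨hT.mem_of_mem_support hp (p.fst_mem_support_of_mem_edges he) hv.1 hv.2,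
    hT.mem_of_mem_support hp (p.snd_mem_support_of_mem_edges he) hv.1 hv.2⟩

/-- A clique tree has maximum weight among all trees on the maximal cliques. -/
theorem IsCliqueTree.totalWeight_le {σ : Finset V → ℕ} (hσ : G.IsLegitimateWeighting σ)
    (hT : G.IsCliqueTree T) (hT' : T'.IsTree) : G.totalWeight σ T' ≤ G.totalWeight σ T := by
  -- `T'` moves towards `T`; the trees in between range over all trees on the maximal cliques.
  induction hn : (T'.edgeSet \ T.edgeSet).ncard using Nat.strong_induction_on generalizing T' with
  | _ n ih =>
  by_cases heq : T' = T
  · rw [heq]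
  obtain ⟨C, D, hCD', hCD⟩ := hT.1.exists_adj_of_ne hT' heq
  obtain ⟨P, Q, hPQ, hPQ', hsub, htree, -⟩ := hT.exists_swapEdge hT' hCD' hCD
  have hdiag : ¬ (s(P, Q)).IsDiag := hPQ.ne
  have hlt : ((T'.swapEdge s(C, D) s(P, Q)).edgeSet \ T.edgeSet).ncard < n := by
    rw [← hn]
    refine Set.ncard_lt_ncard ⟨?_, fun h => ?_⟩ (Set.toFinite _)
    · rw [edgeSet_swapEdge _ _ hdiag]
      rintro g ⟨rfl | hg, hgT⟩
      · exact absurd hPQ hgT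
      · exact ⟨hg.1, hgT⟩
    · have hmem := h (show s(C, D) ∈ _ from ⟨hCD', hCD⟩)
      rw [edgeSet_swapEdge _ _ hdiag] at hmem
      rcases hmem.1 with hg | hg
      · exact hCD (by rw [← mem_edgeSet, hg]; exact hPQ)
      · exact hg.2 rfl
  have h1 := ih _ hlt htree rfl
  have h2 := totalWeight_swapEdge σ (show s(C, D) ∈ T'.edgeSet from hCD')
    (show s(P, Q) ∉ T'.edgeSet from hPQ') hdiag
  have h3 : G.edgeWeight σ s(C, D) ≤ G.edgeWeight σ s(P, Q) :=
    hσ.le_of_subset hCD'.ne hPQ.ne hsub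
  omega

/-- Maximum-weight spanning trees of the reduced clique graph are clique trees. -/
theorem IsCliqueTree.isCliqueTree_of_isMaxWeightSpanningTree {σ : Finset V → ℕ}
    (hσ : G.IsLegitimateWeighting σ) (hconn : G.Connected) (hT : G.IsCliqueTree T)
    (hT' : G.IsMaxWeightSpanningTree σ T') : G.IsCliqueTree T' := by
  -- Now `T'` is fixed and the clique tree `T` moves towards it.
  induction hn : (T'.edgeSet \ T.edgeSet).ncard using Nat.strong_induction_on generalizing T with
  | _ n ih =>
  by_cases heq : T' = T
  · rw [heq]
    exact hT
  obtain ⟨⟨hle, htree'⟩, hmax⟩ := hT'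
  obtain ⟨C, D, hCD', hCD⟩ := hT.1.exists_adj_of_ne htree' heq
  obtain ⟨P, Q, hPQ, hPQ', hsub, htree, hswap⟩ := hT.exists_swapEdge htree' hCD' hCD
  have hdiag : ¬ (s(P, Q)).IsDiag := hPQ.ne
  have hdiag' : ¬ (s(C, D)).IsDiag := hCD'.ne
  have hspan : T'.swapEdge s(C, D) s(P, Q) ≤ G.reducedCliqueGraph := by
    rw [← edgeSet_subset_edgeSet, edgeSet_swapEdge _ _ hdiag]
    rintro g (rfl | hg)
    · exact hT.le_reducedCliqueGraph hconn hPQ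
    · exact edgeSet_subset_edgeSet.2 hle hg.1
  have hw := hmax _ ⟨hspan, htree⟩
  have h2 := totalWeight_swapEdge σ (show s(C, D) ∈ T'.edgeSet from hCD')
    (show s(P, Q) ∉ T'.edgeSet from hPQ') hdiag
  have hσle : σ (P.1 ∩ Q.1) ≤ σ (C.1 ∩ D.1) := by
    have h3 : G.edgeWeight σ s(C, D) = σ (C.1 ∩ D.1) := rfl
    have h4 : G.edgeWeight σ s(P, Q) = σ (P.1 ∩ Q.1) := rfl
    omega
  -- A proper inclusion would make the exchanged tree heavier than `T'`.
  have hsub' : P.1 ∩ Q.1 ⊆ C.1 ∩ D.1 := by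
    rcases hsub.eq_or_ssubset with h | h
    · exact h.symm.subset
    · exact absurd (hσ.2 _ (Or.inr ⟨C, D, hCD'.ne, rfl⟩) _ (Or.inr ⟨P, Q, hPQ.ne, rfl⟩) h)
        hσle.not_gt
  refine ih _ ?_ (hswap hsub') rfl
  rw [← hn]
  refine Set.ncard_lt_ncard ⟨?_, fun h => ?_⟩ (Set.toFinite _)
  · rw [edgeSet_swapEdge _ _ hdiag']
    rintro g ⟨hg, hgT⟩
    refine ⟨hg, fun hgT' => hgT (Or.inr ⟨hgT', ?_⟩)⟩
    rintro rfl
    exact hPQ' hg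
  · have hmem := h (show s(C, D) ∈ _ from ⟨hCD', hCD⟩)
    rw [edgeSet_swapEdge _ _ hdiag'] at hmem
    exact hmem.2 (Or.inl rfl)

end MaxWeight

end SimpleGraph

theorem mainTheorem1 {V : Type*} [Fintype V] [DecidableEq V] (G : SimpleGraph V)
    (hconn : G.Connected) (hchordal : G.IsChordal) :
    -- every clique tree is a spanning tree of the reduced clique graph
    (∀ T : SimpleGraph G.MaxClique, G.IsCliqueTree T → T.IsSpanningTreeOf G.reducedCliqueGraph) ∧
    -- every edge of the reduced clique graph is contained in a clique tree
    (∀ C D : G.MaxClique, G.reducedCliqueGraph.Adj C D →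
      ∃ T : SimpleGraph G.MaxClique, G.IsCliqueTree T ∧ T.Adj C D) ∧
    -- clique trees are the maximum-weight spanning trees, for every legitimate weighting
    (∀ σ : Finset V → ℕ, G.IsLegitimateWeighting σ →
      ∀ T : SimpleGraph G.MaxClique, T.IsSpanningTreeOf G.reducedCliqueGraph →
        (G.IsCliqueTree T ↔ G.IsMaxWeightSpanningTree σ T)) ∧
    -- in particular for the sizes of the intersections
    G.IsLegitimateWeighting Finset.card ∧
    (∀ T : SimpleGraph G.MaxClique, T.IsSpanningTreeOf G.reducedCliqueGraph →
      (G.IsCliqueTree T ↔ G.IsMaxWeightSpanningTree Finset.card T)) := by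
  have := hconn.nonempty
  obtain ⟨T₀, hT₀⟩ := hchordal.exists_isCliqueTree
  have hiff : ∀ σ : Finset V → ℕ, G.IsLegitimateWeighting σ →
      ∀ T : SimpleGraph G.MaxClique, T.IsSpanningTreeOf G.reducedCliqueGraph →
        (G.IsCliqueTree T ↔ G.IsMaxWeightSpanningTree σ T) := fun σ hσ T hT =>
    ⟨fun h => ⟨hT, fun T' hT' => h.totalWeight_le hσ hT'.2⟩,
      hT₀.isCliqueTree_of_isMaxWeightSpanningTree hσ hconn⟩
  exact ⟨fun T hT => ⟨hT.le_reducedCliqueGraph hconn, hT.1⟩,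
    fun C D hCD => SimpleGraph.exists_isCliqueTree_adj hT₀ hCD, hiff, G.isLegitimateWeighting_card,
    hiff _ G.isLegitimateWeighting_card⟩
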